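/- **Setting.** Let $G(\mathbb C)\subset GL(n,\mathbb C)$ be a complex connected reductive algebraic group with Lie algebra $\mathfrak g$, let $\sigma_0$ be a real form of $G(\mathbb C)$ and $\sigma_c$ a compact real form commuting with $\sigma_0$. Put $G=G(\mathbb C)^{\sigma_0}$, $\theta=\sigma_0\sigma_c$ (the Cartan involution), $K=G^\theta$ and $K(\mathbb C)=G(\mathbb C)^\theta$. Let $T_f\subset K$ be a maximal torus and $H_f(\mathbb C)=Z_{G(\mathbb C)}(T_f)$; fix a $\theta$-stable system of positive roots of $H_f(\mathbb C)$ in $\mathfrak g$, and root vectors $X_\alpha$ for the simple roots $\alpha$ with $\theta(X_\alpha)=X_{\theta\alpha}$ if $\theta\alpha\neq\alpha$ and $\sigma_c(X_\alpha)=-X_{-\alpha}$, where $[X_\alpha,X_{-\alpha}]=H_\alpha$ is the coroot element. Let $\delta_f$ be the involutive algebraic automorphism of $G(\mathbb C)$ that agrees with $\theta$ on $H_f(\mathbb C)$ and satisfies $\delta_f(X_\alpha)=X_{\theta\alpha}$ for all simple $\alpha$. The extended groups are ${}^\delta G(\mathbb C)=G(\mathbb C)\rtimes\{1,\delta_f\}$,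 ${}^\delta K(\mathbb C)=K(\mathbb C)\rtimes\{1,\delta_f\}$, ${}^\delta K=K\rtimes\{1,\delta_f\}$; real forms are extended to them by acting trivially on $\delta_f$. For $L(\mathbb C)=K(\mathbb C)$ or ${}^\delta K(\mathbb C)$ and $\sigma=\sigma_0$ or $\sigma_c$, a $\sigma$-invariant Hermitian form on a $(\mathfrak g,L(\mathbb C))$-module $V$ is a Hermitian form (linear in the first variable) with $\langle X v,w\rangle=\langle v,-\sigma(X)w\rangle$ and $\langle \ell v,w\rangle=\langle v,\sigma(\ell^{-1})w\rangle$ for $X\in\mathfrak g$, $\ell\in L(\mathbb C)$. It is called *invariant* if $\sigma=\sigma_0$ and *$c$-invariant* if $\sigma=\sigma_c$. For an irreducible algebraic representation $\mu$ of $L(\mathbb C)$ on $E_\mu$, with a Hilbert space structure on $E_\mu$ invariant under the compact form $L$ of $L(\mathbb C)$, put $V^\mu=\operatorname{Hom}_{L(\mathbb C)}(E_\mu,V)$. The form on $V$ induces the form on $V^\mu$ with $\langle Se,Tf\rangle_V=\langle S,T\rangle_{V^\mu}\langle e,f\rangle_\mu$, and $\mathrm{POS}_V(\mu)$, $\mathrm{NEG}_V(\mu)$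 are the dimensions of maximal positive, respectively negative, definite subspaces of $V^\mu$. **Theorem (extended groups).** Let $x=x_0\delta_f$ with $x_0\in K$ be a strong involution, that is, $\mathrm{Ad}(x)|_{G(\mathbb C)}=\theta$; put $z=x^2$. Let $\zeta\in\mathbb C^\times$ and fix a square root $\zeta^{1/2}$. Let $J'$ be an irreducible $(\mathfrak g,{}^\delta K(\mathbb C))$-module of real infinitesimal character on which $z$ acts by $\zeta$, and let $\langle,\rangle^c_{J'}$ be any $c$-invariant Hermitian form on $J'$ (for instance one that is positive on the lowest ${}^\delta K$-types). Then $$\langle v,w\rangle^0_{J'}=\zeta^{-1/2}\langle x\cdot v,w\rangle^c_{J'}=\zeta^{1/2}\langle v,x\cdot w\rangle^c_{J'}$$ is an invariant Hermitian form on $J'$. On every irreducible algebraic representation $\mu'$ of ${}^\delta K(\mathbb C)$ on which $z$ acts by $\zeta$, the element $x$ acts by the scalar $\epsilon(\mu')\zeta^{1/2}$ with a sign $\epsilon(\mu')=\pm1$; the forms on the multiplicity spaces are related by $$\langle,\rangle^0_{(J')^{\mu'}}=\epsilon(\mu')\,\langle,\rangle^c_{(J')^{\mu'}},$$ and consequently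 $$(\mathrm{POS}^0_{J'}(\mu'),\mathrm{NEG}^0_{J'}(\mu'))=\begin{cases}(\mathrm{POS}^c_{J'}(\mu'),\mathrm{NEG}^c_{J'}(\mu'))&\epsilon(\mu')=+1,\\(\mathrm{NEG}^c_{J'}(\mu'),\mathrm{POS}^c_{J'}(\mu'))&\epsilon(\mu')=-1.\end{cases}$$ **Theorem (equal rank groups).** Suppose there is a strong involution $x\in G$ with $\mathrm{Ad}(x)=\theta$ (so that $G$ is of equal rank), and put $z=x^2$. Let $\zeta\in\mathbb C^\times$ and fix a square root $\zeta^{1/2}$. Let $J$ be an irreducible $(\mathfrak g,K(\mathbb C))$-module on which $z$ acts by $\zeta$, and let $\langle,\rangle^c_J$ be a $c$-invariant Hermitian form on $J$. Then $\langle v,w\rangle^0_J=\zeta^{-1/2}\langle x\cdot v,w\rangle^c_J$ is an invariant Hermitian form on $J$. On every irreducible algebraic representation $\mu$ of $K(\mathbb C)$ on which $z$ acts by $\zeta$, the element $x$ acts by $\epsilon(\mu)\zeta^{1/2}$ with $\epsilon(\mu)=\pm1$; one has $\langle,\rangle^0_{J^\mu}=\epsilon(\mu)\langle,\rangle^c_{J^\mu}$,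 and $(\mathrm{POS}^0_J(\mu),\mathrm{NEG}^0_J(\mu))$ equals $(\mathrm{POS}^c_J(\mu),\mathrm{NEG}^c_J(\mu))$ if $\epsilon(\mu)=+1$ and $(\mathrm{NEG}^c_J(\mu),\mathrm{POS}^c_J(\mu))$ if $\epsilon(\mu)=-1$. -/

import Mathlib

open scoped ComplexConjugate

attribute [local instance 100] LieRing.ofAssociativeRing

noncomputable section

namespace RealRed

/-! ### Complex algebraic groups, their regular functions and Lie algebras -/

/-- The group `GL(n, ℂ)`, with its usual topology. -/
abbrev GLn (n : ℕ) : Type := Matrix.GeneralLinearGroup (Fin n) ℂ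

/-- The matrix entries and the inverse of the determinant. -/
def coordFunctions (n : ℕ) : Set (GLn n → ℂ) :=
  {f | (∃ i j, f = fun g : GLn n => (g : Matrix (Fin n) (Fin n) ℂ) i j) ∨
    f = fun g : GLn n => ((g : Matrix (Fin n) (Fin n) ℂ).det)⁻¹}

/-- Polynomial functions in the matrix entries and the inverse of the determinant. -/
def polyFunctions (n : ℕ) : Subalgebra ℂ (GLn n → ℂ) :=
  Algebra.adjoin ℂ (coordFunctions n)

/-- Restriction of functions from `GL(n, ℂ)` to a subgroup. -/
def restrict {n : ℕ} (G : Subgroup (GLn n)) : (GLn n → ℂ) →ₐ[ℂ] (G → ℂ) where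
  toFun f g := f g
  map_one' := rfl
  map_mul' _ _ := rfl
  map_zero' := rfl
  map_add' _ _ := rfl
  commutes' _ := rfl

/-- The algebra `R(G)` of regular functions on `G`. -/
def regularFunctions {n : ℕ} (G : Subgroup (GLn n)) : Subalgebra ℂ (G → ℂ) :=
  (polyFunctions n).map (restrict G)

/-- `G` is a complex connected reductive algebraic group: a connected zero locus in `GL(n, ℂ)` of
polynomials in the matrix entries and the inverse of the determinant, without nontrivial normal
subgroups consisting of unipotent matrices. -/
structure IsConnectedReductive {n : ℕ} (G : Subgroup (GLn n)) : Prop where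
  algebraic : ∃ S : Set (GLn n → ℂ), S ⊆ (polyFunctions n : Set (GLn n → ℂ)) ∧
    ∀ g : GLn n, g ∈ G ↔ ∀ f ∈ S, f g = 0
  connected : IsConnected (G : Set (GLn n))
  reductive : ∀ N : Subgroup G, N.Normal →
    (∀ g ∈ N, IsNilpotent ((g.1 : Matrix (Fin n) (Fin n) ℂ) - 1)) → N = ⊥

theorem poly_comp_mul {n : ℕ} (a b : GLn n) (f : GLn n → ℂ) (hf : f ∈ polyFunctions n) :
    (fun g => f (a * g * b)) ∈ polyFunctions n := by
  have entry : ∀ i j, (fun g : GLn n => (g : Matrix (Fin n) (Fin n) ℂ) i j) ∈ polyFunctions n :=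
    fun i j => Algebra.subset_adjoin (Or.inl ⟨i, j, rfl⟩)
  have cst : ∀ c : ℂ, (fun _ : GLn n => c) ∈ polyFunctions n :=
    fun c => (polyFunctions n).algebraMap_mem c
  induction hf using Algebra.adjoin_induction with
  | mem f hf =>
    rcases hf with ⟨i, j, rfl⟩ | rfl
    · have : (fun g : GLn n => ((a * g * b : GLn n) : Matrix (Fin n) (Fin n) ℂ) i j) =
          ∑ l, ∑ k, (fun _ : GLn n => (a : Matrix (Fin n) (Fin n) ℂ) i k) *
            (fun g : GLn n => (g : Matrix (Fin n) (Fin n) ℂ) k l) *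
            (fun _ : GLn n => (b : Matrix (Fin n) (Fin n) ℂ) l j) := by
        funext g
        simp [Matrix.mul_apply, Finset.sum_mul]
      rw [this]
      exact sum_mem fun l _ => sum_mem fun k _ =>
        mul_mem (mul_mem (cst _) (entry k l)) (cst _)
    · have : (fun g : GLn n => (((a * g * b : GLn n) : Matrix (Fin n) (Fin n) ℂ).det)⁻¹) =
          (fun _ : GLn n => ((a : Matrix (Fin n) (Fin n) ℂ).det)⁻¹ *
            ((b : Matrix (Fin n) (Fin n) ℂ).det)⁻¹) *
          (fun g : GLn n => ((g : Matrix (Fin n) (Fin n) ℂ).det)⁻¹) := by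
        funext g
        simp [Matrix.det_mul]
        ring
      rw [this]
      exact mul_mem (cst _) (Algebra.subset_adjoin (Or.inr rfl))
  | algebraMap c => exact cst c
  | add f g _ _ hf hg => exact add_mem hf hg
  | mul f g _ _ hf hg => exact mul_mem hf hg

theorem regular_comp_mul {n : ℕ} {G : Subgroup (GLn n)} (a b : G) (f : G → ℂ)
    (hf : f ∈ regularFunctions G) : (fun g => f (a * g * b)) ∈ regularFunctions G := by
  obtain ⟨F, hF, rfl⟩ := hf
  exact ⟨_, poly_comp_mul (a : GLn n) (b : GLn n) F hF, rfl⟩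

/-- The algebra of regular functions on `G`, as a type. -/
def Reg {n : ℕ} (G : Subgroup (GLn n)) : Type := regularFunctions G

instance {n : ℕ} (G : Subgroup (GLn n)) : CommRing (Reg G) :=
  inferInstanceAs (CommRing (regularFunctions G))

instance {n : ℕ} (G : Subgroup (GLn n)) : Algebra ℂ (Reg G) :=
  inferInstanceAs (Algebra ℂ (regularFunctions G))

/-- A regular function as a function on `G`. -/
def Reg.fn {n : ℕ} {G : Subgroup (GLn n)} (f : Reg G) : G → ℂ := f.1

theorem Reg.fn_mem {n : ℕ} {G : Subgroup (GLn n)} (f : Reg G) : f.fn ∈ regularFunctions G := f.2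

/-- The element of `R(G)` given by a regular function. -/
def Reg.mk {n : ℕ} {G : Subgroup (GLn n)} (f : G → ℂ) (hf : f ∈ regularFunctions G) : Reg G :=
  ⟨f, hf⟩

theorem Reg.mk_fn {n : ℕ} {G : Subgroup (GLn n)} (f : G → ℂ) (hf : f ∈ regularFunctions G) :
    (Reg.mk f hf).fn = f := rfl

@[ext]
theorem Reg.ext {n : ℕ} {G : Subgroup (GLn n)} {f g : Reg G} (h : ∀ x, f.fn x = g.fn x) :
    f = g := Subtype.ext (funext h)

theorem Reg.add_apply {n : ℕ} {G : Subgroup (GLn n)} (f g : Reg G) (x : G) :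
    (f + g).fn x = f.fn x + g.fn x := rfl

theorem Reg.mul_apply {n : ℕ} {G : Subgroup (GLn n)} (f g : Reg G) (x : G) :
    (f * g).fn x = f.fn x * g.fn x := rfl

theorem Reg.sub_apply {n : ℕ} {G : Subgroup (GLn n)} (f g : Reg G) (x : G) :
    (f - g).fn x = f.fn x - g.fn x := rfl

theorem Reg.smul_apply {n : ℕ} {G : Subgroup (GLn n)} (a : ℂ) (f : Reg G) (x : G) :
    (a • f).fn x = a * f.fn x := rfl

theorem Reg.zero_apply {n : ℕ} {G : Subgroup (GLn n)} (x : G) : (0 : Reg G).fn x = 0 := rfl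

/-- Left translation `(a · f)(h) = f(ah)` of regular functions. -/
def leftTranslate {n : ℕ} {G : Subgroup (GLn n)} (a : G) :
    Reg G →ₐ[ℂ] Reg G where
  toFun f := Reg.mk (fun h => f.fn (a * h)) (by simpa using regular_comp_mul a 1 f.fn f.fn_mem)
  map_one' := rfl
  map_mul' _ _ := rfl
  map_zero' := rfl
  map_add' _ _ := rfl
  commutes' _ := rfl

theorem leftTranslate_apply {n : ℕ} {G : Subgroup (GLn n)} (a : G) (f : Reg G)
    (g : G) : (leftTranslate a f).fn g = f.fn (a * g) := rfl

/-- The Lie algebra `𝔤` of `G`: the left-invariant derivations of `R(G)`. -/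
def lieAlg {n : ℕ} (G : Subgroup (GLn n)) :
    LieSubalgebra ℂ (Derivation ℂ (Reg G) (Reg G)) where
  carrier := {D | ∀ (a : G) (f : Reg G),
    D (leftTranslate a f) = leftTranslate a (D f)}
  add_mem' {D E} hD hE a f := by
    rw [Derivation.add_apply, Derivation.add_apply, hD a f, hE a f, map_add]
  zero_mem' a f := by rw [Derivation.zero_apply, Derivation.zero_apply, map_zero]
  smul_mem' c D hD a f := by
    rw [Derivation.smul_apply, Derivation.smul_apply, hD a f, map_smul]
  lie_mem' {D E} hD hE a f := by
    simp only [Derivation.commutator_apply, map_sub]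
    rw [hE a f, hD a f, hD a, hE a]

/-- The Lie algebra `𝔤` of `G`, as a type. -/
def LieG {n : ℕ} (G : Subgroup (GLn n)) : Type := lieAlg G

instance {n : ℕ} (G : Subgroup (GLn n)) : LieRing (LieG G) :=
  inferInstanceAs (LieRing (lieAlg G))

instance {n : ℕ} (G : Subgroup (GLn n)) : LieAlgebra ℂ (LieG G) :=
  inferInstanceAs (LieAlgebra ℂ (lieAlg G))

/-- An element of `𝔤` as a derivation. -/
def LieG.der {n : ℕ} {G : Subgroup (GLn n)} (D : LieG G) : Derivation ℂ (Reg G) (Reg G) := D.1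

theorem LieG.der_leftTranslate {n : ℕ} {G : Subgroup (GLn n)} (D : LieG G) (a : G) (f : Reg G) :
    D.der (leftTranslate a f) = leftTranslate a (D.der f) := D.2 a f

/-- The element of `𝔤` given by a left-invariant derivation. -/
def LieG.mk {n : ℕ} {G : Subgroup (GLn n)} (D : Derivation ℂ (Reg G) (Reg G))
    (hD : ∀ a f, D (leftTranslate a f) = leftTranslate a (D f)) : LieG G := ⟨D, hD⟩

theorem LieG.mk_der {n : ℕ} {G : Subgroup (GLn n)} (D : Derivation ℂ (Reg G) (Reg G))
    (hD : ∀ a f, D (leftTranslate a f) = leftTranslate a (D f)) : (LieG.mk D hD).der = D := rfl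

theorem LieG.ext {n : ℕ} {G : Subgroup (GLn n)} {D E : LieG G} (h : ∀ f, D.der f = E.der f) :
    D = E := Subtype.ext (Derivation.ext h)

theorem LieG.add_apply {n : ℕ} {G : Subgroup (GLn n)} (D E : LieG G) (f : Reg G) :
    (D + E).der f = D.der f + E.der f := rfl

theorem LieG.smul_apply {n : ℕ} {G : Subgroup (GLn n)} (a : ℂ) (D : LieG G) (f : Reg G) :
    (a • D).der f = a • D.der f := rfl

theorem LieG.zero_apply {n : ℕ} {G : Subgroup (GLn n)} (f : Reg G) :
    (0 : LieG G).der f = 0 := rfl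

theorem LieG.lie_apply {n : ℕ} {G : Subgroup (GLn n)} (D E : LieG G) (f : Reg G) :
    ⁅D, E⁆.der f = D.der (E.der f) - E.der (D.der f) := rfl

/-- The Lie algebra of a closed subgroup `H` of `G`, inside the Lie algebra of `G`: the
left-invariant derivations preserving the ideal of `H`. -/
def lieOf {n : ℕ} {G : Subgroup (GLn n)} (H : Subgroup G) : LieSubalgebra ℂ (LieG G) where
  carrier := {D | ∀ f : Reg G, (∀ h ∈ H, f.fn h = 0) → ∀ h ∈ H, (D.der f).fn h = 0}
  add_mem' {D E} hD hE f hf h hh := by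
    rw [LieG.add_apply, Reg.add_apply, hD f hf h hh, hE f hf h hh, add_zero]
  zero_mem' f hf h hh := by rw [LieG.zero_apply, Reg.zero_apply]
  smul_mem' c D hD f hf h hh := by
    rw [LieG.smul_apply, Reg.smul_apply, hD f hf h hh, mul_zero]
  lie_mem' {D E} hD hE f hf h hh := by
    rw [LieG.lie_apply, Reg.sub_apply, hD (E.der f) (hE f hf) h hh, hE (D.der f) (hD f hf) h hh,
      sub_zero]

/-- The automorphisms of the algebraic group `G`. -/
def algAut {n : ℕ} (G : Subgroup (GLn n)) : Subgroup (MulAut G) where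
  carrier := {φ | ∀ f ∈ regularFunctions G,
    (fun g => f (φ g)) ∈ regularFunctions G ∧ (fun g => f (φ⁻¹ g)) ∈ regularFunctions G}
  one_mem' f hf := ⟨hf, hf⟩
  mul_mem' {φ ψ} hφ hψ f hf := by
    refine ⟨(hψ _ (hφ f hf).1).1, ?_⟩
    have := (hφ _ (hψ f hf).2).2
    simpa [mul_inv_rev] using this
  inv_mem' {φ} hφ f hf := by
    refine ⟨(hφ f hf).2, ?_⟩
    simpa using (hφ f hf).1

/-- Pullback `f ↦ f ∘ φ` of regular functions. -/
def pullback {n : ℕ} {G : Subgroup (GLn n)} (φ : algAut G) :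
    Reg G →ₐ[ℂ] Reg G where
  toFun f := Reg.mk (fun g => f.fn (φ.1 g)) (φ.2 f.fn f.fn_mem).1
  map_one' := rfl
  map_mul' _ _ := rfl
  map_zero' := rfl
  map_add' _ _ := rfl
  commutes' _ := rfl

theorem pullback_apply {n : ℕ} {G : Subgroup (GLn n)} (φ : algAut G) (f : Reg G)
    (g : G) : (pullback φ f).fn g = f.fn (φ.1 g) := rfl

theorem pullback_inv {n : ℕ} {G : Subgroup (GLn n)} (φ : algAut G) (f : Reg G) :
    pullback φ⁻¹ (pullback φ f) = f := by
  ext g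
  rw [pullback_apply, pullback_apply]
  exact congrArg f.fn (φ.1.apply_symm_apply g)

theorem pullback_leftTranslate {n : ℕ} {G : Subgroup (GLn n)} (φ : algAut G) (a : G)
    (f : Reg G) : pullback φ (leftTranslate (φ.1 a) f) = leftTranslate a (pullback φ f) := by
  ext g
  simp only [pullback_apply, leftTranslate_apply, map_mul]

theorem pullback_inv_leftTranslate {n : ℕ} {G : Subgroup (GLn n)} (φ : algAut G) (a : G)
    (f : Reg G) :
    pullback φ⁻¹ (leftTranslate a f) = leftTranslate (φ.1 a) (pullback φ⁻¹ f) := by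
  rw [← pullback_leftTranslate]
  have : (φ⁻¹).1 (φ.1 a) = a := φ.1.symm_apply_apply a
  rw [this]

/-- The derivation `f ↦ D(f ∘ φ) ∘ φ⁻¹`. -/
def differentialDer {n : ℕ} {G : Subgroup (GLn n)} (φ : algAut G)
    (D : Derivation ℂ (Reg G) (Reg G)) : Derivation ℂ (Reg G) (Reg G) :=
  Derivation.mk'
    ((pullback φ⁻¹).toLinearMap ∘ₗ D.toLinearMap ∘ₗ (pullback φ).toLinearMap)
    (fun f g => by
      change pullback φ⁻¹ (D (pullback φ (f * g))) =
        f * pullback φ⁻¹ (D (pullback φ g)) + g * pullback φ⁻¹ (D (pullback φ f))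
      rw [map_mul, Derivation.leibniz, map_add, smul_eq_mul, smul_eq_mul, map_mul, map_mul,
        pullback_inv, pullback_inv])

theorem differentialDer_apply {n : ℕ} {G : Subgroup (GLn n)} (φ : algAut G)
    (D : Derivation ℂ (Reg G) (Reg G)) (f : Reg G) :
    differentialDer φ D f = pullback φ⁻¹ (D (pullback φ f)) := rfl

/-- The differential of an automorphism `φ` of `G`, an endomorphism of the Lie algebra:
`(dφ)(D) f = D(f ∘ φ) ∘ φ⁻¹`. -/
def differential {n : ℕ} {G : Subgroup (GLn n)} (φ : algAut G) : LieG G →ₗ[ℂ] LieG G where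
  toFun D := LieG.mk (differentialDer φ D.der) fun a f => by
    obtain ⟨b, rfl⟩ : ∃ b, φ.1 b = a := φ.1.surjective a
    rw [differentialDer_apply, differentialDer_apply, pullback_leftTranslate,
      D.der_leftTranslate, pullback_inv_leftTranslate]
  map_add' D E := LieG.ext fun f => map_add (pullback φ⁻¹) _ _
  map_smul' a D := LieG.ext fun f => map_smul (pullback φ⁻¹) a _

/-- Inner automorphisms `h ↦ g h g⁻¹` are algebraic. -/
def conjAut {n : ℕ} (G : Subgroup (GLn n)) : G →* algAut G :=
  (MulAut.conj : G →* MulAut G).codRestrict (algAut G) (fun a f hf =>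
    ⟨by simpa using regular_comp_mul a a⁻¹ f hf,
     by simpa [← map_inv] using regular_comp_mul a⁻¹ a f hf⟩)

theorem conjAut_apply {n : ℕ} {G : Subgroup (GLn n)} (g h : G) :
    (conjAut G g).1 h = g * h * g⁻¹ := rfl

/-! ### Real forms and Cartan involutions -/

/-- A real form of `G`: an automorphism `σ` of the abstract group with `σ² = 1`, such that
`σ* f = conj (f ∘ σ)` is regular for every regular function `f`. -/
structure RealForm {n : ℕ} (G : Subgroup (GLn n)) where
  toAut : MulAut G
  sq : toAut * toAut = 1
  anti : ∀ f ∈ regularFunctions G, (fun g => conj (f (toAut g))) ∈ regularFunctions G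

/-- The map `σ* f = conj (f ∘ σ)` on regular functions. -/
def RealForm.star {n : ℕ} {G : Subgroup (GLn n)} (σ : RealForm G) :
    Reg G →ₛₗ[starRingEnd ℂ] Reg G where
  toFun f := Reg.mk (fun g => conj (f.fn (σ.toAut g))) (σ.anti f.fn f.fn_mem)
  map_add' _ _ := Reg.ext fun _ => map_add (starRingEnd ℂ) _ _
  map_smul' _ _ := Reg.ext fun _ => map_mul (starRingEnd ℂ) _ _

theorem RealForm.star_apply {n : ℕ} {G : Subgroup (GLn n)} (σ : RealForm G) (f : Reg G) (g : G) :
    (σ.star f).fn g = conj (f.fn (σ.toAut g)) := rfl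

theorem RealForm.apply_apply {n : ℕ} {G : Subgroup (GLn n)} (σ : RealForm G) (g : G) :
    σ.toAut (σ.toAut g) = g :=
  congrArg (fun φ : MulAut G => φ g) σ.sq

theorem RealForm.star_star {n : ℕ} {G : Subgroup (GLn n)} (σ : RealForm G)
    (f : Reg G) : σ.star (σ.star f) = f := by
  ext x
  rw [star_apply, star_apply, σ.apply_apply, Complex.conj_conj]

theorem RealForm.star_mul {n : ℕ} {G : Subgroup (GLn n)} (σ : RealForm G)
    (f g : Reg G) : σ.star (f * g) = σ.star f * σ.star g :=
  Reg.ext fun _ => map_mul (starRingEnd ℂ) _ _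

theorem RealForm.star_leftTranslate {n : ℕ} {G : Subgroup (GLn n)} (σ : RealForm G) (a : G)
    (f : Reg G) : σ.star (leftTranslate a f) = leftTranslate (σ.toAut a) (σ.star f) := by
  ext g
  simp only [star_apply, leftTranslate_apply, map_mul, σ.apply_apply]

/-- The derivation `σ* D σ*`. -/
def RealForm.differentialDer {n : ℕ} {G : Subgroup (GLn n)} (σ : RealForm G)
    (D : Derivation ℂ (Reg G) (Reg G)) : Derivation ℂ (Reg G) (Reg G) :=
  Derivation.mk'
    { toFun := fun f => σ.star (D (σ.star f))
      map_add' := fun f g => by rw [map_add, map_add, map_add]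
      map_smul' := fun c f => by
        rw [map_smulₛₗ, Derivation.map_smul, map_smulₛₗ, Complex.conj_conj, RingHom.id_apply] }
    (fun f g => by
      change σ.star (D (σ.star (f * g))) =
        f * σ.star (D (σ.star g)) + g * σ.star (D (σ.star f))
      rw [σ.star_mul, Derivation.leibniz, map_add, smul_eq_mul, smul_eq_mul, σ.star_mul,
        σ.star_mul, σ.star_star, σ.star_star])

theorem RealForm.differentialDer_apply {n : ℕ} {G : Subgroup (GLn n)} (σ : RealForm G)
    (D : Derivation ℂ (Reg G) (Reg G)) (f : Reg G) :
    σ.differentialDer D f = σ.star (D (σ.star f)) := rfl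

/-- The differential of a real form, a conjugate-linear map of the Lie algebra:
`(dσ)(D) = σ* D σ*` (recall that `σ*` is its own inverse). -/
def RealForm.differential {n : ℕ} {G : Subgroup (GLn n)} (σ : RealForm G) :
    LieG G →ₛₗ[starRingEnd ℂ] LieG G where
  toFun D := LieG.mk (σ.differentialDer D.der) fun a f => by
    rw [differentialDer_apply, differentialDer_apply, σ.star_leftTranslate,
      D.der_leftTranslate, σ.star_leftTranslate, σ.apply_apply]
  map_add' D E := LieG.ext fun f => map_add σ.star _ _
  map_smul' c D := LieG.ext fun f => map_smulₛₗ σ.star c _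

/-- A real form `σ₀` of `G` together with a commuting compact real form `σc`. -/
structure CartanData {n : ℕ} (G : Subgroup (GLn n)) where
  σ₀ : RealForm G
  σc : RealForm G
  comm : σ₀.toAut * σc.toAut = σc.toAut * σ₀.toAut
  compact : IsCompact {g : G | σc.toAut g = g}

variable {n : ℕ} {G : Subgroup (GLn n)}

namespace CartanData

variable (c : CartanData G)

/-- The Cartan involution `θ = σ₀ ∘ σc`, an automorphism of the algebraic group `G`. -/
def θ : algAut G :=
  ⟨c.σ₀.toAut * c.σc.toAut, by
    have key : ∀ (σ τ : RealForm G), ∀ f ∈ regularFunctions G,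
        (fun g => f ((σ.toAut * τ.toAut) g)) ∈ regularFunctions G := by
      intro σ τ f hf
      have := τ.anti _ (σ.anti f hf)
      simpa using this
    intro f hf
    refine ⟨key _ _ f hf, ?_⟩
    have e : (c.σ₀.toAut * c.σc.toAut)⁻¹ = c.σc.toAut * c.σ₀.toAut := by
      rw [mul_inv_rev, inv_eq_of_mul_eq_one_left c.σc.sq, inv_eq_of_mul_eq_one_left c.σ₀.sq]
    rw [e]
    exact key _ _ f hf⟩

/-- The complexification `K(ℂ) = G(ℂ)^θ` of the maximal compact subgroup. -/
def KC : Subgroup G where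
  carrier := {g | c.θ.1 g = g}
  one_mem' := map_one _
  mul_mem' {a b} ha hb := by
    change c.θ.1 (a * b) = a * b
    rw [map_mul, ha, hb]
  inv_mem' {a} ha := by
    change c.θ.1 a⁻¹ = a⁻¹
    rw [map_inv, ha]

/-- The maximal compact subgroup `K = G(ℝ)^θ` of the group `G(ℝ) = G(ℂ)^σ₀` of real points. -/
def K : Subgroup G where
  carrier := {g | c.σ₀.toAut g = g ∧ c.θ.1 g = g}
  one_mem' := ⟨map_one _, map_one _⟩
  mul_mem' {a b} ha hb := by
    refine ⟨?_, ?_⟩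
    · rw [map_mul, ha.1, hb.1]
    · rw [map_mul, ha.2, hb.2]
  inv_mem' {a} ha := by
    refine ⟨?_, ?_⟩
    · rw [map_inv, ha.1]
    · rw [map_inv, ha.2]

end CartanData

/-! ### Fundamental tori, roots and pinnings -/

/-- A connected abelian subgroup of `K`. -/
def IsConnectedAbelianIn (K T : Subgroup G) : Prop :=
  T ≤ K ∧ (∀ a ∈ T, ∀ b ∈ T, a * b = b * a) ∧ IsConnected (T : Set G)

/-- A maximal torus `T_f` of `K`: a maximal connected abelian subgroup. -/
structure FundamentalTorus (c : CartanData G) where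
  Tf : Subgroup G
  isConnectedAbelian : IsConnectedAbelianIn c.K Tf
  maximal : ∀ T' : Subgroup G, IsConnectedAbelianIn c.K T' → Tf ≤ T' → T' = Tf

namespace FundamentalTorus

variable {c : CartanData G} (T : FundamentalTorus c)

/-- The fundamental complex maximal torus `H_f(ℂ)`, the centralizer of `T_f` in `G(ℂ)`. -/
def Hf : Subgroup G := Subgroup.centralizer (T.Tf : Set G)

theorem θ_mem (h : G) (hh : h ∈ T.Hf) : c.θ.1 h ∈ T.Hf := by
  intro t ht
  have h1 : c.θ.1 t = t := (T.isConnectedAbelian.1 ht).2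
  have h2 : t * h = h * t := hh t ht
  have h3 := congrArg c.θ.1 h2
  rwa [map_mul, map_mul, h1] at h3

/-- The restriction of `θ` to `H_f(ℂ)`. -/
def θH : T.Hf →* T.Hf :=
  (c.θ.1.toMonoidHom.comp T.Hf.subtype).codRestrict T.Hf (fun h => T.θ_mem h.1 h.2)

/-- `χ` is an element of the lattice `X*` of algebraic characters of `H_f(ℂ)`. The group law
of `X*` is written multiplicatively. -/
def IsAlgChar (χ : T.Hf →* ℂˣ) : Prop :=
  ∃ F : Reg G, ∀ h : T.Hf, F.fn h = (χ h : ℂ)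

/-- The action of `θ` on characters (recall that `θ` is its own inverse). -/
def θChar (χ : T.Hf →* ℂˣ) : T.Hf →* ℂˣ := χ.comp T.θH

/-- The weight space of weight `χ` in `𝔤` for the adjoint action of `H_f(ℂ)`. -/
def rootSpace (χ : T.Hf →* ℂˣ) : Submodule ℂ (LieG G) where
  carrier := {X | ∀ h : T.Hf, differential (conjAut G h.1) X = (χ h : ℂ) • X}
  add_mem' {X Y} hX hY h := by rw [map_add, hX h, hY h, smul_add]
  zero_mem' h := by simp
  smul_mem' a X hX h := by rw [map_smul, hX h, smul_comm]

/-- The roots: the nonzero weights of `H_f(ℂ)` in `𝔤`. -/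
def roots : Set (T.Hf →* ℂˣ) :=
  {χ | T.IsAlgChar χ ∧ χ ≠ 1 ∧ T.rootSpace χ ≠ ⊥}

/-- A system of positive roots. -/
structure IsPositiveSystem (P : Set (T.Hf →* ℂˣ)) : Prop where
  subset : P ⊆ T.roots
  pos_or_neg : ∀ α ∈ T.roots, α ∈ P ∨ α⁻¹ ∈ P
  not_both : ∀ α ∈ P, α⁻¹ ∉ P
  closed : ∀ α ∈ P, ∀ β ∈ P, α * β ∈ T.roots → α * β ∈ P

/-- The simple roots of a positive system: the positive roots that are not the sum of two
positive roots. -/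
def simple (P : Set (T.Hf →* ℂˣ)) : Set (T.Hf →* ℂˣ) :=
  {α | α ∈ P ∧ ¬ ∃ β ∈ P, ∃ γ ∈ P, α = β * γ}

/-- The Lie algebra of `H_f(ℂ)`. -/
def 𝔥 : LieSubalgebra ℂ (LieG G) := lieOf T.Hf

open Classical in
/-- The differential of an algebraic character, as a linear functional on the Lie algebra of
`H_f(ℂ)`: if the regular function `F` extends `χ`, its value at `D` is `(D F)(1)`. -/
def dChar (χ : T.Hf →* ℂˣ) : Module.Dual ℂ T.𝔥 :=
  if hχ : T.IsAlgChar χ then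
    { toFun := fun D => (D.1.der hχ.choose).fn 1
      map_add' := fun _ _ => rfl
      map_smul' := fun _ _ => rfl }
  else 0

/-- The canonical real form of the dual of the Lie algebra of `H_f(ℂ)`: the real span of the
differentials of the algebraic characters. -/
def realDual : Submodule ℝ (Module.Dual ℂ T.𝔥) :=
  Submodule.span ℝ (T.dChar '' {χ | T.IsAlgChar χ})

/-- Half the sum of the positive roots. -/
def rho (P : Set (T.Hf →* ℂˣ)) : Module.Dual ℂ T.𝔥 :=
  (1 / 2 : ℂ) • ∑ᶠ α ∈ P, T.dChar α

/-- The natural map from the enveloping algebra of the fundamental Cartan subalgebra to that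
of `𝔤`. -/
def envIncl : UniversalEnvelopingAlgebra ℂ T.𝔥 →ₐ[ℂ] UniversalEnvelopingAlgebra ℂ (LieG G) :=
  UniversalEnvelopingAlgebra.lift ℂ ((UniversalEnvelopingAlgebra.ι ℂ).comp T.𝔥.incl)

/-- The left ideal `U(𝔤)𝔫` generated by the positive root vectors. -/
def leftIdeal (P : Set (T.Hf →* ℂˣ)) : Ideal (UniversalEnvelopingAlgebra ℂ (LieG G)) :=
  Ideal.span (UniversalEnvelopingAlgebra.ι ℂ '' {X | ∃ α ∈ P, X ∈ T.rootSpace α})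

end FundamentalTorus

/-- A `θ`-stable positive system for the fundamental torus, together with a pinning: root
vectors `X α` for the simple roots `α`, compatible with `θ` and with the compact real form. -/
structure Pinning {c : CartanData G} (T : FundamentalTorus c) where
  pos : Set (T.Hf →* ℂˣ)
  isPositive : T.IsPositiveSystem pos
  θ_stable : ∀ α ∈ pos, T.θChar α ∈ pos
  X : (T.Hf →* ℂˣ) → LieG G
  X_mem : ∀ α ∈ T.simple pos, X α ∈ T.rootSpace α
  X_ne : ∀ α ∈ T.simple pos, X α ≠ 0
  θ_X : ∀ β ∈ T.simple pos, T.θChar β ≠ β → differential c.θ (X β) = X (T.θChar β)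
  /-- The root vector `X_{-α}` with `[X_α, X_{-α}] = H_α` is `-σc(X_α)`; here `H_α` is the element
  of `[𝔤_α, 𝔤_{-α}]` with `[H_α, X_α] = 2 X_α`. -/
  sl2 : ∀ α ∈ T.simple pos,
    ⁅⁅X α, -c.σc.differential (X α)⁆, X α⁆ = (2 : ℂ) • X α

/-! ### Extended groups and strong involutions -/

/-- The group `{1, δ_f}` of order two. -/
abbrev C2 : Type := Multiplicative (ZMod 2)

/-- The nontrivial element of `{1, δ_f}`. -/
def C2.gen : C2 := Multiplicative.ofAdd 1

/-- The data defining the extended group: a fundamental torus, a pinning, and the action of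
`{1, δ_f}` on `G(ℂ)` by algebraic automorphisms, where `δ_f` is the lift of the action of `θ` on
the based root datum that preserves the pinning: it agrees with `θ` on `H_f(ℂ)` (that is, it
preserves `H_f(ℂ)` and acts as `θ` on its characters) and permutes the vectors `X_α`. -/
structure ExtendedData (c : CartanData G) where
  T : FundamentalTorus c
  pin : Pinning T
  act : C2 →* algAut G
  δ_torus : ∀ h ∈ T.Hf, (act C2.gen).1 h = c.θ.1 h
  δ_X : ∀ α ∈ T.simple pin.pos, differential (act C2.gen) (pin.X α) = pin.X (T.θChar α)

namespace ExtendedData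

variable {c : CartanData G} (d : ExtendedData c)

/-- The extended group `G(ℂ) ⋊ {1, δ_f}`. -/
abbrev Gδ : Type := G ⋊[(algAut G).subtype.comp d.act] C2

/-- The action of the extended group on `G(ℂ)` by conjugation. -/
def ad : d.Gδ →* algAut G :=
  SemidirectProduct.lift (conjAut G) d.act (by
    intro e
    ext1 g
    apply Subtype.ext
    apply MulEquiv.ext
    intro h
    change (d.act e).1 g * h * ((d.act e).1 g)⁻¹ =
      (d.act e).1 (g * (d.act e).1.symm h * g⁻¹)
    rw [map_mul, map_mul, map_inv, MulEquiv.apply_symm_apply])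

/-- The extension of an automorphism of the abstract group `G(ℂ)` (a real form) to the extended
group, acting trivially on `δ_f`. -/
def extendMap (σ : MulAut G) (l : d.Gδ) : d.Gδ := ⟨σ l.left, l.right⟩

/-- The group `K(ℂ) ⋊ {1, δ_f}`, the subgroup generated by `K(ℂ)` and `δ_f`. -/
def KCδ : Subgroup d.Gδ :=
  c.KC.map SemidirectProduct.inl ⊔ (SemidirectProduct.inr : C2 →* d.Gδ).range

end ExtendedData

/-- A strong involution for `G` in `K δ_f`: an element `x = x₀ δ_f` of the extended group with
`x₀ ∈ K` whose conjugation action on `G(ℂ)` is `θ`. -/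
structure StrongInvolution {c : CartanData G} (d : ExtendedData c) where
  x₀ : G
  mem_K : x₀ ∈ c.K
  ad_eq : d.ad (SemidirectProduct.inl x₀ * SemidirectProduct.inr C2.gen) = c.θ

/-- A strong involution in the equal rank case: an element `x` of the group `G(ℂ)^σ₀` of real
points whose conjugation action is `θ`. -/
structure EqualRankStrongInvolution (c : CartanData G) where
  x : G
  real : c.σ₀.toAut x = x
  ad_eq : conjAut G x = c.θ

/-! ### Pairs and their modules -/

/-- Bookkeeping device to treat the pairs `(𝔤, K(ℂ))` and `(𝔤, K(ℂ) ⋊ {1, δ_f})` at the same time;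
the only instances used are `gKPair` and `gKδPair`. It records an ambient group `Γ` containing
`G(ℂ)`, its conjugation action on `G(ℂ)`, the extension of real forms of `G(ℂ)` to `Γ`, and
the subgroup `L` containing `K(ℂ)`. -/
structure AmbientPair (c : CartanData G) where
  Γ : Type
  [group : Group Γ]
  incl : G →* Γ
  ad : Γ →* algAut G
  extendMap : MulAut G → Γ → Γ
  L : Subgroup Γ
  KC_le : c.KC.map incl ≤ L

attribute [instance] AmbientPair.group

/-- The pair `(𝔤, K(ℂ))`. -/
abbrev gKPair (c : CartanData G) : AmbientPair c where
  Γ := G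
  incl := MonoidHom.id G
  ad := conjAut G
  extendMap := fun σ g => σ g
  L := c.KC
  KC_le := by simp

/-- The pair `(𝔤, K(ℂ) ⋊ {1, δ_f})`. -/
abbrev gKδPair {c : CartanData G} (d : ExtendedData c) : AmbientPair c where
  Γ := d.Gδ
  incl := SemidirectProduct.inl
  ad := d.ad
  extendMap := d.extendMap
  L := d.KCδ
  KC_le := le_sup_left

/-- The strong involution as an element of `K(ℂ)`. -/
def EqualRankStrongInvolution.elt {c : CartanData G} (x : EqualRankStrongInvolution c) :
    (gKPair c).L :=
  ⟨x.x, by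
    change c.θ.1 x.x = x.x
    rw [← x.ad_eq]
    rw [conjAut_apply, mul_inv_cancel_right]⟩

/-- The strong involution `x₀ δ_f` as an element of `K(ℂ) ⋊ {1, δ_f}`. -/
def StrongInvolution.elt {c : CartanData G} {d : ExtendedData c} (x : StrongInvolution d) :
    (gKδPair d).L :=
  ⟨SemidirectProduct.inl x.x₀ * SemidirectProduct.inr C2.gen,
    mul_mem (le_sup_left (a := c.KC.map SemidirectProduct.inl) ⟨x.x₀, x.mem_K.2, rfl⟩)
      (le_sup_right (a := c.KC.map SemidirectProduct.inl) ⟨C2.gen, rfl⟩)⟩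

namespace AmbientPair

variable {c : CartanData G} (P : AmbientPair c)

/-- The inclusion of `K(ℂ)` in `L`. -/
def inclK : c.KC →* P.L :=
  (P.incl.comp c.KC.subtype).codRestrict P.L (fun k => P.KC_le ⟨k.1, k.2, rfl⟩)

/-- A representation `π` of `L` on `V` is algebraic: it is locally finite, and its matrix
coefficients are regular functions on every coset of `K(ℂ)`. -/
structure IsAlgebraic {V : Type*} [AddCommGroup V] [Module ℂ V]
    (π : Representation ℂ P.L V) : Prop where
  locallyFinite : ∀ v : V,
    FiniteDimensional ℂ (Submodule.span ℂ (Set.range fun l : P.L => π l v))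
  regular : ∀ (v : V) (f : Module.Dual ℂ V) (l : P.L), ∃ F : Reg G,
    ∀ k : c.KC, f (π (P.inclK k * l) v) = F.fn k

/-- The structure of a `(𝔤, L)`-module on `V`. -/
structure HCModule (V : Type*) [AddCommGroup V] [Module ℂ V] where
  ρ : LieG G →ₗ⁅ℂ⁆ Module.End ℂ V
  π : Representation ℂ P.L V
  algebraic : P.IsAlgebraic π
  /-- The differential of the action of `K(ℂ)` is the action of its Lie algebra: the derivative at
  the identity along `D` of each matrix coefficient is the matrix coefficient of `ρ D`. -/
  differential_eq : ∀ D ∈ lieOf c.KC, ∀ (v : V) (f : Module.Dual ℂ V) (F : Reg G),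
    (∀ k : c.KC, f (π (P.inclK k) v) = F.fn k) → f (ρ D v) = (D.der F).fn 1
  equivariant : ∀ (l : P.L) (X : LieG G) (v : V),
    π l (ρ X v) = ρ (differential (P.ad l) X) (π l v)

end AmbientPair

open AmbientPair

section Modules

variable {c : CartanData G} {P : AmbientPair c}
variable {V : Type*} [AddCommGroup V] [Module ℂ V]

/-- `V` is an irreducible `(𝔤, L)`-module. -/
def AmbientPair.HCModule.IsIrreducible (M : P.HCModule V) : Prop :=
  Nontrivial V ∧ ∀ W : Submodule ℂ V,
    (∀ X, ∀ v ∈ W, M.ρ X v ∈ W) → (∀ l, ∀ v ∈ W, M.π l v ∈ W) → W = ⊥ ∨ W = ⊤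

/-- The irreducible module `V` has real infinitesimal character: for some `lam` in the canonical
real form of the dual of the fundamental Cartan subalgebra, the center of `U(𝔤)` acts on some
nonzero vector by the infinitesimal character `lam`. The value of the latter on a central `u` is
`p(lam - ρ)`, where `p` is the element of the (commutative) enveloping algebra of the Cartan
subalgebra with `p - u ∈ U(𝔤)𝔫`; evaluation at `lam - ρ` is the algebra homomorphism `ev`. -/
def AmbientPair.HCModule.HasRealInfChar (M : P.HCModule V) {T : FundamentalTorus c}
    (pin : Pinning T) : Prop :=
  ∃ lam ∈ T.realDual, ∃ ev : UniversalEnvelopingAlgebra ℂ T.𝔥 →ₐ[ℂ] ℂ,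
    (∀ X : T.𝔥, ev (UniversalEnvelopingAlgebra.ι ℂ X) = lam X - T.rho pin.pos X) ∧
    ∃ v : V, v ≠ 0 ∧
      ∀ u ∈ Subalgebra.center ℂ (UniversalEnvelopingAlgebra ℂ (LieG G)),
      ∀ p : UniversalEnvelopingAlgebra ℂ T.𝔥, T.envIncl p - u ∈ T.leftIdeal pin.pos →
        (UniversalEnvelopingAlgebra.lift ℂ M.ρ u) v = ev p • v

/-- A Hermitian form (linear in the first, conjugate linear in the second variable) on the module
`V` that is invariant with respect to the real form `σ`. -/
structure IsInvariantHermitian (M : P.HCModule V) (σ : RealForm G)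
    (B : V →ₗ[ℂ] V →ₗ⋆[ℂ] ℂ) : Prop where
  hermitian : ∀ v w, B v w = conj (B w v)
  lie_invariant : ∀ (X : LieG G) (v w : V), B (M.ρ X v) w = B v (M.ρ (-σ.differential X) w)
  group_invariant : ∀ l l' : P.L, (l' : P.Γ) = P.extendMap σ.toAut ((l⁻¹ : P.L) : P.Γ) →
    ∀ v w, B (M.π l v) w = B v (M.π l' w)

/-- An irreducible algebraic representation `μ` of `L` on the finite-dimensional Hilbert space
`E`, unitary for the compact real form `{k ∈ L | σ₀ k = k}` of `L`. -/
structure LType (P : AmbientPair c) (E : Type*) [NormedAddCommGroup E] [InnerProductSpace ℂ E]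
    [FiniteDimensional ℂ E] where
  μ : Representation ℂ P.L E
  algebraic : P.IsAlgebraic μ
  nontrivial : Nontrivial E
  irreducible : ∀ W : Submodule ℂ E, (∀ l, ∀ v ∈ W, μ l v ∈ W) → W = ⊥ ∨ W = ⊤
  unitary : ∀ k : P.L, P.extendMap c.σ₀.toAut k = k → ∀ e f, inner ℂ (μ k e) (μ k f) = inner ℂ e f

variable {E : Type*} [NormedAddCommGroup E] [InnerProductSpace ℂ E] [FiniteDimensional ℂ E]

/-- The multiplicity space `V^μ = Hom_L(E, V)`. -/
def multSpace (M : P.HCModule V) (τ : LType P E) : Submodule ℂ (E →ₗ[ℂ] V) where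
  carrier := {S | ∀ l e, S (τ.μ l e) = M.π l (S e)}
  add_mem' {S T} hS hT l e := by simp [hS l e, hT l e]
  zero_mem' l e := by simp
  smul_mem' a S hS l e := by simp [hS l e]

/-- The form on the multiplicity space `V^μ` induced by an invariant form `B` on `V`. It is the
form determined by `B (S e) (T f) = ⟨S, T⟩ ⟨e, f⟩`; as this identity determines it
(see `multForm_eq`), it is obtained by averaging `B (S e) (T e)` over an orthonormal basis. -/
def multForm (M : P.HCModule V) (τ : LType P E) (B : V →ₗ[ℂ] V →ₗ⋆[ℂ] ℂ) :
    multSpace M τ →ₗ[ℂ] multSpace M τ →ₗ⋆[ℂ] ℂ :=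
  LinearMap.mk₂'ₛₗ (RingHom.id ℂ) (starRingEnd ℂ)
    (fun S T => (Module.finrank ℂ E : ℂ)⁻¹ *
      ∑ i, B (S.1 (stdOrthonormalBasis ℂ E i)) (T.1 (stdOrthonormalBasis ℂ E i)))
    (fun S S' T => by simp [Finset.sum_add_distrib, mul_add])
    (fun a S T => by simp [← Finset.mul_sum, mul_left_comm])
    (fun S T T' => by simp [Finset.sum_add_distrib, mul_add])
    (fun a S T => by simp [← Finset.mul_sum, mul_left_comm])

theorem multForm_eq (M : P.HCModule V) (τ : LType P E) (B : V →ₗ[ℂ] V →ₗ⋆[ℂ] ℂ)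
    (b : multSpace M τ → multSpace M τ → ℂ)
    (hb : ∀ S T : multSpace M τ, ∀ e f : E, B (S.1 e) (T.1 f) = b S T * inner ℂ f e)
    (S T : multSpace M τ) : multForm M τ B S T = b S T := by
  have := τ.nontrivial
  have h0 : (Module.finrank ℂ E : ℂ) ≠ 0 := by
    exact_mod_cast (Module.finrank_pos (R := ℂ) (M := E)).ne'
  simp [multForm, hb, h0]

end Modules

/-! ### Signatures -/

/-- The dimension of a maximal subspace on which the Hermitian form `b` is positive definite. -/
def posIndex {W : Type*} [AddCommGroup W] [Module ℂ W] (b : W →ₗ[ℂ] W →ₗ⋆[ℂ] ℂ) : ℕ∞ :=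
  ⨆ (U : Submodule ℂ W) (_ : ∀ u ∈ U, u ≠ 0 → 0 < (b u u).re), (Module.rank ℂ U).toENat

/-- The dimension of a maximal subspace on which the Hermitian form `b` is negative definite. -/
def negIndex {W : Type*} [AddCommGroup W] [Module ℂ W] (b : W →ₗ[ℂ] W →ₗ⋆[ℂ] ℂ) : ℕ∞ :=
  ⨆ (U : Submodule ℂ W) (_ : ∀ u ∈ U, u ≠ 0 → (b u u).re < 0), (Module.rank ℂ U).toENat

section Signature

variable {c : CartanData G} {P : AmbientPair c}
variable {V : Type*} [AddCommGroup V] [Module ℂ V]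
variable {E : Type*} [NormedAddCommGroup E] [InnerProductSpace ℂ E] [FiniteDimensional ℂ E]

/-- The signature function `POS` of the form `B` on the module `V`, at `μ`. -/
def POS (M : P.HCModule V) (B : V →ₗ[ℂ] V →ₗ⋆[ℂ] ℂ) (τ : LType P E) : ℕ∞ :=
  posIndex (multForm M τ B)

/-- The signature function `NEG` of the form `B` on the module `V`, at `μ`. -/
def NEG (M : P.HCModule V) (B : V →ₗ[ℂ] V →ₗ⋆[ℂ] ℂ) (τ : LType P E) : ℕ∞ :=
  negIndex (multForm M τ B)

open Classical in
/-- The sign `ε(μ)`, for an `L`-type `μ` on which `x` acts by `ε(μ) s` with `ε(μ) = ±1`. -/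
def typeSign (τ : LType P E) (x : P.L) (s : ℂ) : ℂ :=
  if ∀ e, τ.μ x e = s • e then 1 else -1

/-- The form `⟨v, w⟩⁰ = s⁻¹ ⟨x v, w⟩`. -/
def changedForm (M : P.HCModule V) (x : P.L) (s : ℂ) (B : V →ₗ[ℂ] V →ₗ⋆[ℂ] ℂ) :
    V →ₗ[ℂ] V →ₗ⋆[ℂ] ℂ :=
  s⁻¹ • (B ∘ₗ M.π x)

end Signature

end RealRed

end

/-!
Both halves of the theorem follow from one computation with an element `x` of `L` that is central
in `L`, is fixed by `σc` and acts on `G(ℂ)` by the Cartan involution `θ = σ₀ σc`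
(`AmbientPair.IsStrong`).

* *Strong involutions are such elements.* If `x = x₀ δ_f` with `x₀ ∈ K`, then `θ = Ad(x)` fixes
  `x₀`, which forces `δ_f` to fix `x₀`. Hence `x` commutes with `δ_f`, and it commutes with `K(ℂ)`
  because `K(ℂ)` is the fixed point group of `θ`. On `L` the two real forms coincide, since
  `σ₀ = σc` on the fixed points of `σ₀ σc`.
* *The changed form is invariant.* On `𝔤` one has `σc ∘ dθ = σ₀`
  (`CartanData.differential_σc_θ`), so moving `x` past `X ∈ 𝔤` turns `c`-invariance into
  invariance (`changedForm_isInvariantHermitian`).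
  The form is Hermitian because `z = x²` preserves `⟨,⟩ᶜ`, so that `|ζ| = 1` unless the form
  vanishes (`mul_conj_eq_one_of_ne_zero`).
* *Signs and signatures.* On an `L`-type with `x² = ζ = s²`, the eigenspace of the central element
  `x` for the eigenvalue `s` is zero or everything, so `x = ± s` (`LType.apply_eq_typeSign`).
  Vectors in the image of an `L`-map from the type inherit this eigenvalue, so the form on the
  multiplicity space changes by the sign, and a sign `-1` exchanges the two signature functions.
-/

namespace RealRed

variable {n : ℕ} {G : Subgroup (GLn n)}

/-! ### The two real forms and the Cartan involution -/

theorem CartanData.θ_apply (c : CartanData G) (g : G) :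
    c.θ.1 g = c.σ₀.toAut (c.σc.toAut g) := rfl

theorem CartanData.comm_apply (c : CartanData G) (g : G) :
    c.σ₀.toAut (c.σc.toAut g) = c.σc.toAut (c.σ₀.toAut g) :=
  congrArg (fun φ : MulAut G => φ g) c.comm

theorem CartanData.σc_eq_σ₀_of_θ_eq (c : CartanData G) {g : G} (h : c.θ.1 g = g) :
    c.σc.toAut g = c.σ₀.toAut g := by
  rw [c.θ_apply] at h
  conv_rhs => rw [← h]
  rw [c.σ₀.apply_apply]

theorem CartanData.θ_inv_apply (c : CartanData G) (g : G) : (c.θ⁻¹).1 g = c.θ.1 g := by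
  apply c.θ.1.injective
  have h1 : c.θ.1 ((c.θ⁻¹).1 g) = g := c.θ.1.apply_symm_apply g
  rw [h1, c.θ_apply, c.θ_apply, c.comm_apply, c.σ₀.apply_apply, c.σc.apply_apply]

/-- On the Lie algebra, `σc ∘ θ = σ₀`. -/
theorem CartanData.differential_σc_θ (c : CartanData G) (X : LieG G) :
    c.σc.differential (RealRed.differential c.θ X) = c.σ₀.differential X := by
  have pull : ∀ f : Reg G, pullback c.θ (c.σc.star f) = c.σ₀.star f := fun f => by
    ext g
    rw [pullback_apply, RealForm.star_apply, RealForm.star_apply, c.θ_apply, c.comm_apply,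
      c.σc.apply_apply]
  have star : ∀ f : Reg G, c.σc.star (pullback c.θ⁻¹ f) = c.σ₀.star f := fun f => by
    ext g
    rw [RealForm.star_apply, RealForm.star_apply, pullback_apply, c.θ_inv_apply, c.θ_apply,
      c.σc.apply_apply]
  apply LieG.ext
  intro f
  change c.σc.star (pullback c.θ⁻¹ (X.der (pullback c.θ (c.σc.star f)))) =
    c.σ₀.star (X.der (c.σ₀.star f))
  rw [pull, star]

/-! ### Signatures and signs -/

theorem posIndex_neg {W : Type*} [AddCommGroup W] [Module ℂ W] (b : W →ₗ[ℂ] W →ₗ⋆[ℂ] ℂ) :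
    posIndex (-b) = negIndex b := by
  simp [posIndex, negIndex]

theorem negIndex_neg {W : Type*} [AddCommGroup W] [Module ℂ W] (b : W →ₗ[ℂ] W →ₗ⋆[ℂ] ℂ) :
    negIndex (-b) = posIndex b := by
  simp [posIndex, negIndex]

/-! ### Changing the form by a strong involution -/

section Pair

variable {c : CartanData G} {P : AmbientPair c}

/-- The properties of a strong involution `x ∈ L` on which the comparison of forms rests: `x` is
central in `L`, fixed by `σc`, and acts on `G(ℂ)` by `θ`; moreover the two real forms agree
on `L`. -/
structure AmbientPair.IsStrong (P : AmbientPair c) (x : P.L) : Prop where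
  comm : ∀ l : P.L, x * l = l * x
  ad_eq : P.ad x = c.θ
  σc_inv : P.extendMap c.σc.toAut ((x⁻¹ : P.L) : P.Γ) = ((x⁻¹ : P.L) : P.Γ)
  σc_eq_σ₀ : ∀ l : P.L, P.extendMap c.σc.toAut (l : P.Γ) = P.extendMap c.σ₀.toAut (l : P.Γ)

variable {V : Type*} [AddCommGroup V] [Module ℂ V]
variable {E : Type*} [NormedAddCommGroup E] [InnerProductSpace ℂ E] [FiniteDimensional ℂ E]

theorem changedForm_apply (M : P.HCModule V) (x : P.L) (s : ℂ) (B : V →ₗ[ℂ] V →ₗ⋆[ℂ] ℂ)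
    (v w : V) : changedForm M x s B v w = s⁻¹ * B (M.π x v) w := rfl

theorem apply_apply_of_sq {M : P.HCModule V} {x : P.L} {ζ : ℂ}
    (hz : ∀ v, M.π (x * x) v = ζ • v) (v : V) : M.π x (M.π x v) = ζ • v := by
  rw [← hz v, map_mul, Module.End.mul_apply]

/-- A strong involution preserves a `c`-invariant form. -/
theorem isometry_of_isStrong {M : P.HCModule V} {x : P.L} (hx : P.IsStrong x)
    {B : V →ₗ[ℂ] V →ₗ⋆[ℂ] ℂ} (hB : IsInvariantHermitian M c.σc B) (v w : V) :
    B (M.π x v) (M.π x w) = B v w := by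
  rw [hB.group_invariant x x⁻¹ hx.σc_inv.symm, ← Module.End.mul_apply, ← map_mul,
    inv_mul_cancel, map_one, Module.End.one_apply]

theorem mul_conj_eq_one_of_ne_zero {M : P.HCModule V} {x : P.L} (hx : P.IsStrong x)
    {B : V →ₗ[ℂ] V →ₗ⋆[ℂ] ℂ} (hB : IsInvariantHermitian M c.σc B) {ζ : ℂ}
    (hz : ∀ v, M.π (x * x) v = ζ • v) {v w : V} (h : B v w ≠ 0) : ζ * conj ζ = 1 := by
  have h1 : B (ζ • v) (ζ • w) = B v w := by
    rw [← apply_apply_of_sq hz, ← apply_apply_of_sq hz, isometry_of_isStrong hx hB,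
      isometry_of_isStrong hx hB]
  rw [(B (ζ • v)).map_smulₛₗ, B.map_smul, LinearMap.smul_apply, smul_eq_mul, smul_eq_mul] at h1
  exact mul_right_cancel₀ h (by linear_combination h1)

/-- The two expressions `s⁻¹ ⟨x v, w⟩` and `s ⟨v, x w⟩` for the changed form agree. -/
theorem inv_mul_apply_eq {M : P.HCModule V} {x : P.L} (hx : P.IsStrong x)
    {B : V →ₗ[ℂ] V →ₗ⋆[ℂ] ℂ} (hB : IsInvariantHermitian M c.σc B) {ζ s : ℂ} (hζ : ζ ≠ 0)
    (hs : s ^ 2 = ζ) (hz : ∀ v, M.π (x * x) v = ζ • v) (v w : V) :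
    s⁻¹ * B (M.π x v) w = s * B v (M.π x w) := by
  have hs0 : s ≠ 0 := by
    rintro rfl
    exact hζ (by simp [← hs])
  -- Applying `x` to both arguments of `B v (x w)` produces `B (x v) (x² w)`.
  have h1 : B v (M.π x w) = conj ζ * B (M.π x v) w := by
    rw [← isometry_of_isStrong hx hB v, apply_apply_of_sq hz, map_smulₛₗ, smul_eq_mul]
  rw [h1]
  by_cases h : B (M.π x v) w = 0
  · simp [h]
  · have h2 := mul_conj_eq_one_of_ne_zero hx hB hz h
    rw [inv_mul_eq_iff_eq_mul₀ hs0]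
    linear_combination (-B (M.π x v) w) * h2 - B (M.π x v) w * conj ζ * hs

theorem changedForm_isInvariantHermitian {M : P.HCModule V} {x : P.L} (hx : P.IsStrong x)
    {B : V →ₗ[ℂ] V →ₗ⋆[ℂ] ℂ} (hB : IsInvariantHermitian M c.σc B) {ζ s : ℂ} (hζ : ζ ≠ 0)
    (hs : s ^ 2 = ζ) (hz : ∀ v, M.π (x * x) v = ζ • v) :
    IsInvariantHermitian M c.σ₀ (changedForm M x s B) where
  hermitian v w := by
    rw [changedForm_apply, changedForm_apply, map_mul, ← hB.hermitian, map_inv₀]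
    by_cases h : B v (M.π x w) = 0
    · rw [inv_mul_apply_eq hx hB hζ hs hz, h, mul_zero, mul_zero]
    · rw [inv_mul_apply_eq hx hB hζ hs hz]
      congr 1
      -- `|s|² = 1`, because its square `|ζ|²` is `1`.
      have h1 := mul_conj_eq_one_of_ne_zero hx hB hz h
      have h2 : Complex.normSq s = 1 := by
        rw [Complex.mul_conj, ← hs, map_pow] at h1
        have h3 : Complex.normSq s ^ 2 = 1 := by exact_mod_cast h1
        exact (pow_eq_one_iff_of_nonneg (Complex.normSq_nonneg s) two_ne_zero).1 h3
      apply eq_inv_of_mul_eq_one_left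
      rw [Complex.mul_conj, h2, Complex.ofReal_one]
  lie_invariant X v w := by
    rw [changedForm_apply, changedForm_apply, M.equivariant, hx.ad_eq, hB.lie_invariant,
      c.differential_σc_θ]
  group_invariant l l' h v w := by
    have h' : (l' : P.Γ) = P.extendMap c.σc.toAut ((l⁻¹ : P.L) : P.Γ) := by
      rw [h, hx.σc_eq_σ₀]
    rw [changedForm_apply, changedForm_apply, ← hB.group_invariant l l' h',
      ← Module.End.mul_apply, ← Module.End.mul_apply, ← map_mul, ← map_mul, hx.comm]

/-- A strong involution with square `s²` acts on an `L`-type by `s` or `-s`: it is central, so its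
eigenspaces are invariant. -/
theorem LType.apply_eq_typeSign (τ : LType P E) {x : P.L} (hx : P.IsStrong x) {ζ s : ℂ}
    (hs : s ^ 2 = ζ) (hz : ∀ e, τ.μ (x * x) e = ζ • e) (e : E) :
    τ.μ x e = (typeSign τ x s * s) • e := by
  unfold typeSign
  split_ifs with h
  · rw [one_mul, h]
  have hW : LinearMap.ker (τ.μ x - s • 1) = ⊥ := by
    refine (τ.irreducible _ fun l v hv => ?_).resolve_right fun hW => h fun e => ?_
    · have hv' : τ.μ x v = s • v := sub_eq_zero.1 hv
      refine sub_eq_zero.2 ?_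
      change τ.μ x (τ.μ l v) = s • τ.μ l v
      rw [← Module.End.mul_apply, ← map_mul, hx.comm, map_mul, Module.End.mul_apply, hv',
        map_smul]
    · have : e ∈ LinearMap.ker (τ.μ x - s • 1) := hW ▸ Submodule.mem_top
      exact sub_eq_zero.1 this
  -- `(x - s) (x + s) = x² - s² = 0`, and `x - s` is injective.
  have hk : τ.μ x e + s • e ∈ LinearMap.ker (τ.μ x - s • 1) := by
    refine sub_eq_zero.2 ?_
    change τ.μ x (τ.μ x e + s • e) = s • (τ.μ x e + s • e)
    have h2 : τ.μ x (τ.μ x e) = ζ • e := by rw [← hz e, map_mul, Module.End.mul_apply]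
    rw [map_add, map_smul, h2, smul_add, smul_smul, ← hs, sq, add_comm]
  rw [hW, Submodule.mem_bot] at hk
  rw [neg_one_mul, neg_smul]
  exact eq_neg_of_add_eq_zero_left hk

theorem multForm_changedForm (M : P.HCModule V) (τ : LType P E) (B : V →ₗ[ℂ] V →ₗ⋆[ℂ] ℂ)
    {x : P.L} {s a : ℂ} (hs : s ≠ 0) (h : ∀ e, τ.μ x e = (a * s) • e) :
    multForm M τ (changedForm M x s B) = a • multForm M τ B := by
  ext S T
  change _ * ∑ i, changedForm M x s B _ _ = a * (_ * ∑ i, B _ _)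
  rw [mul_left_comm a, Finset.mul_sum _ _ a]
  refine congrArg _ (Finset.sum_congr rfl fun i _ => ?_)
  rw [changedForm_apply, ← S.2, h, map_smul, map_smul, LinearMap.smul_apply, smul_eq_mul]
  field_simp

/-- The effect of a strong involution on an `L`-type, on the form on its multiplicity space, and on
the signature functions. -/
theorem signature_changedForm (M : P.HCModule V) {x : P.L} (hx : P.IsStrong x)
    (B : V →ₗ[ℂ] V →ₗ⋆[ℂ] ℂ) {ζ s : ℂ} (hζ : ζ ≠ 0) (hs : s ^ 2 = ζ)
    (τ : LType P E) (hz : ∀ e, τ.μ (x * x) e = ζ • e) :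
    (∀ e, τ.μ x e = (typeSign τ x s * s) • e) ∧
    multForm M τ (changedForm M x s B) = typeSign τ x s • multForm M τ B ∧
    (typeSign τ x s = 1 →
      POS M (changedForm M x s B) τ = POS M B τ ∧
      NEG M (changedForm M x s B) τ = NEG M B τ) ∧
    (typeSign τ x s = -1 →
      POS M (changedForm M x s B) τ = NEG M B τ ∧
      NEG M (changedForm M x s B) τ = POS M B τ) := by
  have hs0 : s ≠ 0 := by
    rintro rfl
    exact hζ (by simp [← hs])
  have h1 := τ.apply_eq_typeSign hx hs hz
  have h2 := multForm_changedForm M τ B hs0 h1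
  refine ⟨h1, h2, fun h => ?_, fun h => ?_⟩
  · rw [h, one_smul] at h2
    simp only [POS, NEG, h2, and_self]
  · rw [h] at h2
    have h3 := h2.trans (neg_one_smul ℂ (multForm M τ B))
    simp only [POS, NEG, h3, posIndex_neg, negIndex_neg, and_self]

end Pair

/-! ### Strong involutions -/

theorem CartanData.σc_eq_of_mem_K (c : CartanData G) {g : G} (h : g ∈ c.K) :
    c.σc.toAut g = g :=
  (c.σc_eq_σ₀_of_θ_eq h.2).trans h.1

theorem EqualRankStrongInvolution.isStrong {c : CartanData G} (x : EqualRankStrongInvolution c) :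
    (gKPair c).IsStrong x.elt := by
  have hθ : c.θ.1 x.x = x.x := x.elt.2
  refine ⟨fun l => ?_, x.ad_eq, ?_, fun l => c.σc_eq_σ₀_of_θ_eq l.2⟩
  · have h : c.θ.1 l.1 = l.1 := l.2
    rw [← x.ad_eq, conjAut_apply, mul_inv_eq_iff_eq_mul] at h
    exact Subtype.ext h
  · exact c.σc_eq_of_mem_K (inv_mem ⟨x.real, hθ⟩)

section Extended

variable {c : CartanData G} {d : ExtendedData c}

theorem StrongInvolution.θ_apply (x : StrongInvolution d) (g : G) :
    c.θ.1 g = x.x₀ * (d.act C2.gen).1 g * x.x₀⁻¹ := by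
  rw [← x.ad_eq, map_mul]
  simp only [ExtendedData.ad, SemidirectProduct.lift_inl, SemidirectProduct.lift_inr]
  rfl

theorem StrongInvolution.act_gen (x : StrongInvolution d) : (d.act C2.gen).1 x.x₀ = x.x₀ := by
  have h := x.mem_K.2
  rw [x.θ_apply, mul_inv_eq_iff_eq_mul] at h
  exact mul_left_cancel h

theorem StrongInvolution.act_apply (x : StrongInvolution d) (e : C2) :
    (d.act e).1 x.x₀ = x.x₀ := by
  have he : e = 1 ∨ e = C2.gen := by
    revert e
    decide
  rcases he with rfl | rfl
  · rw [map_one]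
    rfl
  · exact x.act_gen

theorem StrongInvolution.commute_of_mem (x : StrongInvolution d) {l : d.Gδ} (hl : l ∈ d.KCδ) :
    (x.elt : d.Gδ) * l = l * x.elt := by
  have hle : d.KCδ ≤ Subgroup.centralizer {(x.elt : d.Gδ)} := by
    refine sup_le ?_ ?_
    · rintro _ ⟨k, hk, rfl⟩
      rw [Subgroup.mem_centralizer_singleton_iff]
      have h : c.θ.1 k = k := hk
      rw [x.θ_apply, mul_inv_eq_iff_eq_mul] at h
      refine SemidirectProduct.ext ?_ ?_
      · simpa [StrongInvolution.elt] using h.symm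
      · simp [StrongInvolution.elt]
    · rintro _ ⟨e, rfl⟩
      rw [Subgroup.mem_centralizer_singleton_iff]
      refine SemidirectProduct.ext ?_ ?_
      · simpa [StrongInvolution.elt] using x.act_apply e
      · simp [StrongInvolution.elt, mul_comm]
  exact (Subgroup.mem_centralizer_singleton_iff.1 (hle hl)).symm

theorem StrongInvolution.left_mem_KC (x : StrongInvolution d) {l : d.Gδ} (hl : l ∈ d.KCδ) :
    l.left ∈ c.KC := by
  change c.θ.1 l.left = l.left
  -- The first components of `x l = l x` read `x₀ δ_f(g) = g x₀`, as every element of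
  -- `{1, δ_f}` fixes `x₀`.
  have h := congrArg SemidirectProduct.left (x.commute_of_mem hl)
  rw [x.θ_apply, mul_inv_eq_iff_eq_mul]
  have h2 := x.act_apply l.right
  simpa [StrongInvolution.elt, h2] using h

theorem StrongInvolution.isStrong (x : StrongInvolution d) : (gKδPair d).IsStrong x.elt := by
  refine ⟨fun l => Subtype.ext (x.commute_of_mem l.2), x.ad_eq, ?_, fun l => ?_⟩
  · refine SemidirectProduct.ext ?_ rfl
    have h : ((x.elt⁻¹ : (gKδPair d).L) : d.Gδ).left = x.x₀⁻¹ := by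
      have h2 := x.act_apply C2.gen⁻¹
      simpa [StrongInvolution.elt] using h2
    change c.σc.toAut ((x.elt⁻¹ : (gKδPair d).L) : d.Gδ).left = _
    rw [h]
    exact c.σc_eq_of_mem_K (inv_mem x.mem_K)
  · exact SemidirectProduct.ext (c.σc_eq_σ₀_of_θ_eq (x.left_mem_KC l.2)) rfl

end Extended

end RealRed

open RealRed in
theorem mainTheorem6 {n : ℕ} (G : Subgroup (GLn n)) (hG : IsConnectedReductive G)
    (c : CartanData G)
    (V : Type*) [AddCommGroup V] [Module ℂ V]
    (E : Type*) [NormedAddCommGroup E] [InnerProductSpace ℂ E] [FiniteDimensional ℂ E] :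
    -- extended groups
    (∀ (d : ExtendedData c) (x : StrongInvolution d) (ζ s : ℂ), ζ ≠ 0 → s ^ 2 = ζ →
      ∀ J : (gKδPair d).HCModule V, J.IsIrreducible → J.HasRealInfChar d.pin →
      (∀ v, J.π (x.elt * x.elt) v = ζ • v) →
      ∀ B : V →ₗ[ℂ] V →ₗ⋆[ℂ] ℂ, IsInvariantHermitian J c.σc B →
        (∀ v w, s⁻¹ * B (J.π x.elt v) w = s * B v (J.π x.elt w)) ∧
        IsInvariantHermitian J c.σ₀ (changedForm J x.elt s B) ∧
        ∀ τ : LType (gKδPair d) E, (∀ e, τ.μ (x.elt * x.elt) e = ζ • e) →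
          (∀ e, τ.μ x.elt e = (typeSign τ x.elt s * s) • e) ∧
          multForm J τ (changedForm J x.elt s B) = typeSign τ x.elt s • multForm J τ B ∧
          (typeSign τ x.elt s = 1 →
            POS J (changedForm J x.elt s B) τ = POS J B τ ∧
            NEG J (changedForm J x.elt s B) τ = NEG J B τ) ∧
          (typeSign τ x.elt s = -1 →
            POS J (changedForm J x.elt s B) τ = NEG J B τ ∧
            NEG J (changedForm J x.elt s B) τ = POS J B τ)) ∧
    -- equal rank groups
    (∀ (x : EqualRankStrongInvolution c) (ζ s : ℂ), ζ ≠ 0 → s ^ 2 = ζ →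
      ∀ J : (gKPair c).HCModule V, J.IsIrreducible →
      (∀ v, J.π (x.elt * x.elt) v = ζ • v) →
      ∀ B : V →ₗ[ℂ] V →ₗ⋆[ℂ] ℂ, IsInvariantHermitian J c.σc B →
        IsInvariantHermitian J c.σ₀ (changedForm J x.elt s B) ∧
        ∀ τ : LType (gKPair c) E, (∀ e, τ.μ (x.elt * x.elt) e = ζ • e) →
          (∀ e, τ.μ x.elt e = (typeSign τ x.elt s * s) • e) ∧
          multForm J τ (changedForm J x.elt s B) = typeSign τ x.elt s • multForm J τ B ∧
          (typeSign τ x.elt s = 1 →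
            POS J (changedForm J x.elt s B) τ = POS J B τ ∧
            NEG J (changedForm J x.elt s B) τ = NEG J B τ) ∧
          (typeSign τ x.elt s = -1 →
            POS J (changedForm J x.elt s B) τ = NEG J B τ ∧
            NEG J (changedForm J x.elt s B) τ = POS J B τ)) := by
  refine ⟨fun d x ζ s hζ hs J _ _ hz B hB => ?_, fun x ζ s hζ hs J _ hz B hB => ?_⟩
  · exact ⟨inv_mul_apply_eq x.isStrong hB hζ hs hz,
      changedForm_isInvariantHermitian x.isStrong hB hζ hs hz,
      signature_changedForm J x.isStrong B hζ hs⟩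
  · exact ⟨changedForm_isInvariantHermitian x.isStrong hB hζ hs hz,
      signature_changedForm J x.isStrong B hζ hs⟩
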